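/- All C$^*$-algebras are complex and unital, and embeddings are injective unital $*$-homomorphisms. Terms are built from variables and the constants $0,1$ by addition, multiplication, multiplication by complex scalars and the involution $*$. Quantifier-free formulas are built from the atomic formulas $\|s-t\|$ ($s,t$ terms) by applying continuous functions $\mathbb R^k\to\mathbb R$. An embedding $i:A\to B$ is \emph{existential} if for every quantifier-free formula $\varphi(v,w)$ in finite tuples of variables $v,w$, every integer $n\ge 1$ and every tuple $a$ from $A$, $$\inf\{\varphi(a,b) : b\in A_{\le n}\}=\inf\{\varphi(i(a),c) : c\in B_{\le n}\},$$ where $A_{\le n}$, $B_{\le n}$ denote the closed balls of radius $n$ and $b,c$ run over tuples from these balls. A C$^*$-algebra $A$ is \emph{existentially closed} (e.c.) if every embedding of $A$ into a C$^*$-algebra is existential. For a C$^*$-algebra $A$ let $U_m(A)$ be the unitary group of $M_m(A)$ with the norm topology. For $u\in U_m(A)$, $v\in U_n(A)$ write $u\sim_1 v$ if for some $k\ge\max(m,n)$ the unitaries $u\oplus 1_{k-m}$ and $v\oplus 1_{k-n}$ are joined by a continuous path in $U_k(A)$. Then $K_1(A)$ is the abelian group $\bigl(\bigsqcup_m U_m(A)\bigr)/\!\sim_1$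 with $[u]+[v]=[u\oplus v]$, which equals $[uv]$ when $u$ and $v$ have the same size. \textbf{Proposition.} If $A$ is an e.c. C$^*$-algebra, then $K_1(A)=\{0\}$. -/

import Mathlib

/-! ### Quantifier-free formulas in the continuous-logic language of unital C⋆-algebras -/

/-- Terms of the language of unital C⋆-algebras in the variables `ι`: the function symbols are
`0`, `1`, addition, multiplication, multiplication by each complex scalar, and the involution. -/
inductive CStarTerm (ι : Type) : Type
  | var (i : ι) : CStarTerm ι
  | zero : CStarTerm ι
  | one : CStarTerm ι
  | add (s t : CStarTerm ι) : CStarTerm ι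
  | mul (s t : CStarTerm ι) : CStarTerm ι
  | smul (c : ℂ) (t : CStarTerm ι) : CStarTerm ι
  | star (t : CStarTerm ι) : CStarTerm ι

/-- The value of a term in a unital C⋆-algebra. -/
def CStarTerm.eval {ι : Type} {A : Type*} [CStarAlgebra A] (x : ι → A) : CStarTerm ι → A
  | .var i => x i
  | .zero => 0
  | .one => 1
  | .add s t => s.eval x + t.eval x
  | .mul s t => s.eval x * t.eval x
  | .smul c t => c • t.eval x
  | .star t => Star.star (t.eval x)

/-- Quantifier-free formulas in the variables `ι`: the atomic formulas are `d(s, t)` for terms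
`s`, `t`, and every continuous function `ℝᵏ → ℝ` is a connective. -/
inductive CStarQFFormula (ι : Type) : Type
  | dist (s t : CStarTerm ι) : CStarQFFormula ι
  | conn {k : ℕ} (f : C(Fin k → ℝ, ℝ)) (φ : Fin k → CStarQFFormula ι) : CStarQFFormula ι

/-- The (real) value of a quantifier-free formula in a unital C⋆-algebra. -/
noncomputable def CStarQFFormula.eval {ι : Type} {A : Type*} [CStarAlgebra A] (x : ι → A) :
    CStarQFFormula ι → ℝ
  | .dist s t => ‖s.eval x - t.eval x‖
  | .conn f φ => f fun i => (φ i).eval x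

/-- `inf {φ(a, b) : b ∈ A_{≤ n}}`, the infimum being over tuples `b` with entries of norm at most
`n`. The index set is nonempty, and the values of a quantifier-free formula on a bounded set of
tuples are bounded, so this is a genuine infimum of real numbers. -/
noncomputable def CStarQFFormula.infBall {p q : ℕ} {A : Type*} [CStarAlgebra A]
    (φ : CStarQFFormula (Fin p ⊕ Fin q)) (n : ℕ) (a : Fin p → A) : ℝ :=
  ⨅ b : {b : Fin q → A // ∀ j, ‖b j‖ ≤ n}, φ.eval (Sum.elim a b.1)

/-- An existential embedding of unital C⋆-algebras: an injective unital ⋆-homomorphism `i`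
such that `inf {φ(a, b) : b ∈ A_{≤ n}} = inf {φ(i(a), c) : c ∈ B_{≤ n}}` for every quantifier-free
formula `φ(v, w)`, every `n ≥ 1` and every tuple `a` from `A`. -/
def IsExistentialEmbedding {A B : Type*} [CStarAlgebra A] [CStarAlgebra B]
    (i : A →⋆ₐ[ℂ] B) : Prop :=
  Function.Injective i ∧
    ∀ (p q : ℕ) (φ : CStarQFFormula (Fin p ⊕ Fin q)) (n : ℕ), 1 ≤ n → ∀ a : Fin p → A,
      φ.infBall n a = φ.infBall n (fun j => i (a j))

/-- A unital C⋆-algebra `A` is existentially closed if every embedding of `A` into a unital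
C⋆-algebra is existential. -/
def IsExistentiallyClosedCStar.{u} (A : Type u) [CStarAlgebra A] : Prop :=
  ∀ (B : Type u) [CStarAlgebra B] (i : A →⋆ₐ[ℂ] B), Function.Injective i →
    IsExistentialEmbedding i

/-! ### The group `K₁` of a unital C⋆-algebra -/

namespace CStarK1

section

variable {A : Type*} [CStarAlgebra A]

/-- The `k × k` matrix `u ⊕ 1_{k - n}` (for `n ≤ k`). -/
def pad {n : ℕ} (k : ℕ) (u : CStarMatrix (Fin n) (Fin n) A) : CStarMatrix (Fin k) (Fin k) A :=
  CStarMatrix.ofMatrix fun a b =>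
    if h : (a : ℕ) < n ∧ (b : ℕ) < n then u ⟨a, h.1⟩ ⟨b, h.2⟩ else if a = b then 1 else 0

theorem pad_apply {n k : ℕ} (u : CStarMatrix (Fin n) (Fin n) A) (a b : Fin k) :
    pad k u a b = if h : (a : ℕ) < n ∧ (b : ℕ) < n then u ⟨a, h.1⟩ ⟨b, h.2⟩
      else if (a : ℕ) = b then 1 else 0 := by
  simp only [← Fin.ext_iff]
  rfl

theorem pad_add {n : ℕ} (j : ℕ) (u : CStarMatrix (Fin n) (Fin n) A) :
    pad (n + j) u = CStarMatrix.ofMatrix (Matrix.reindex finSumFinEquiv finSumFinEquiv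
      (Matrix.fromBlocks (CStarMatrix.ofMatrix.symm u) 0 0 1)) := by
  ext a b
  rw [pad_apply, CStarMatrix.ofMatrix_apply]
  induction a using Fin.addCases <;> induction b using Fin.addCases <;>
    simp [Matrix.one_apply, Fin.ext_iff] <;> omega

theorem pad_one {n k : ℕ} : pad k (1 : CStarMatrix (Fin n) (Fin n) A) = 1 := by
  ext a b
  simp only [pad_apply, CStarMatrix.one_apply, Fin.ext_iff]
  split_ifs <;> rfl

theorem pad_star {n k : ℕ} (u : CStarMatrix (Fin n) (Fin n) A) :
    pad k (star u) = star (pad k u) := by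
  ext a b
  simp only [pad_apply, CStarMatrix.star_apply]
  by_cases h : (a : ℕ) < n ∧ (b : ℕ) < n
  · simp [h]
  · rw [dif_neg h, dif_neg (fun h' => h h'.symm)]
    by_cases hab : (a : ℕ) = b
    · simp [hab]
    · simp [hab, Ne.symm hab]

theorem pad_mul {n k : ℕ} (h : n ≤ k) (u v : CStarMatrix (Fin n) (Fin n) A) :
    pad k (u * v) = pad k u * pad k v := by
  obtain ⟨j, rfl⟩ := Nat.exists_eq_add_of_le h
  simp only [pad_add]
  have key : ∀ x y : Matrix (Fin n) (Fin n) A,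
      Matrix.reindex (finSumFinEquiv (n := j)) finSumFinEquiv (Matrix.fromBlocks (x * y) 0 0 (1 : Matrix (Fin j) (Fin j) A)) =
      Matrix.reindex finSumFinEquiv finSumFinEquiv (Matrix.fromBlocks x 0 0 1) *
        Matrix.reindex finSumFinEquiv finSumFinEquiv
          (Matrix.fromBlocks y 0 0 (1 : Matrix (Fin j) (Fin j) A)) := by
    intro x y
    simp [Matrix.submatrix_mul_equiv, Matrix.fromBlocks_multiply]
  exact key u v

theorem pad_pad {n k l : ℕ} (h : n ≤ k) (u : CStarMatrix (Fin n) (Fin n) A) :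
    pad l (pad k u) = pad l u := by
  ext a b
  simp only [pad_apply]
  split_ifs <;> first | rfl | omega

theorem continuous_pad {n : ℕ} (k : ℕ) :
    Continuous (pad k : CStarMatrix (Fin n) (Fin n) A → CStarMatrix (Fin k) (Fin k) A) := by
  refine continuous_pi fun a => continuous_pi fun b => ?_
  by_cases h : (a : ℕ) < n ∧ (b : ℕ) < n
  · simp only [pad_apply, h, and_self, dite_true]
    exact (continuous_apply (⟨b, h.2⟩ : Fin n)).comp
      (continuous_apply (A := fun _ : Fin n => Fin n → A) (⟨a, h.1⟩ : Fin n))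
  · simp only [pad_apply, h, dite_false]
    exact continuous_const

end

/-- `U_n(A)`, the unitary group of `M_n(A)`, with its norm topology. -/
abbrev U (n : ℕ) (A : Type*) [CStarAlgebra A] : Type _ :=
  unitary (CStarMatrix (Fin n) (Fin n) A)

section

variable {A : Type*} [CStarAlgebra A]

instance instContinuousMulU {n : ℕ} : ContinuousMul (CStarMatrix (Fin n) (Fin n) A) :=
  inferInstanceAs (ContinuousMul (Matrix (Fin n) (Fin n) A))

instance instContinuousStarU {n : ℕ} : ContinuousStar (CStarMatrix (Fin n) (Fin n) A) :=
  inferInstanceAs (ContinuousStar (Matrix (Fin n) (Fin n) A))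

/-- The inclusion `U_n(A) → U_k(A)`, `u ↦ u ⊕ 1_{k - n}`, for `n ≤ k`. -/
def padU {n k : ℕ} (h : n ≤ k) : U n A →* U k A where
  toFun u := ⟨pad k u.1, by
    rw [Unitary.mem_iff, ← pad_star, ← pad_mul h, ← pad_mul h]
    simp [pad_one]⟩
  map_one' := Subtype.ext pad_one
  map_mul' u v := Subtype.ext (pad_mul h u.1 v.1)

theorem continuous_padU {n k : ℕ} (h : n ≤ k) : Continuous (padU h : U n A → U k A) :=
  ((continuous_pad k).comp continuous_subtype_val).subtype_mk _

theorem padU_padU {n k l : ℕ} (h : n ≤ k) (h' : k ≤ l) (u : U n A) :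
    padU h' (padU h u) = padU (h.trans h') u :=
  Subtype.ext (pad_pad h u.1)

theorem joined_padU {n k : ℕ} (h : n ≤ k) {u v : U n A} (huv : Joined u v) :
    Joined (padU h u) (padU h v) :=
  huv.map (continuous_padU h)

/-- `u ∼₁ v` for `u ∈ U_m(A)` and `v ∈ U_n(A)`: there is `k ≥ max(m, n)` such that
`u ⊕ 1_{k - m}` and `v ⊕ 1_{k - n}` are joined by a continuous path in `U_k(A)`. -/
def Rel (u v : Σ n, U n A) : Prop :=
  ∃ (k : ℕ) (hu : u.1 ≤ k) (hv : v.1 ≤ k), Joined (padU hu u.2) (padU hv v.2)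

theorem Rel.mk_pad {n k : ℕ} (h : n ≤ k) (u : U n A) : Rel ⟨n, u⟩ ⟨k, padU h u⟩ :=
  ⟨k, h, le_rfl, by simpa only [padU_padU] using Joined.refl _⟩

theorem Rel.trans {u v w : Σ n, U n A} (h₁ : Rel u v) (h₂ : Rel v w) : Rel u w := by
  obtain ⟨k, hu, hv, huv⟩ := h₁
  obtain ⟨l, hv', hw, hvw⟩ := h₂
  refine ⟨max k l, hu.trans (le_max_left _ _), hw.trans (le_max_right _ _), ?_⟩
  have e₁ := joined_padU (le_max_left k l) huv
  have e₂ := joined_padU (le_max_right k l) hvw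
  simp only [padU_padU] at e₁ e₂
  exact Joined.trans e₁ e₂

/-- The equivalence relation `∼₁` on the disjoint union `U_∞(A)` of all `U_n(A)`. -/
def relSetoid (A : Type*) [CStarAlgebra A] : Setoid (Σ n, U n A) where
  r := Rel
  iseqv :=
    { refl := fun u => ⟨u.1, le_rfl, le_rfl, Joined.refl _⟩
      symm := fun ⟨k, hu, hv, h⟩ => ⟨k, hv, hu, h.symm⟩
      trans := Rel.trans }

/-- If `w` is a self-adjoint unitary, then conjugation by `w` does not change the path component
in the unitary group. -/
theorem joined_conj {n : ℕ} (w q : U n A) (hw : star w = w) : Joined q (w * q * star w) := by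
  have hw1 : star (w : CStarMatrix (Fin n) (Fin n) A) = w := congrArg Subtype.val hw
  have hw2 : (w : CStarMatrix (Fin n) (Fin n) A) * w = 1 := by
    have h := Unitary.star_mul_self_of_mem w.2
    rwa [hw1] at h
  let W : CStarMatrix (Fin n) (Fin n) A := w
  let r : ℝ → CStarMatrix (Fin n) (Fin n) A := fun t =>
    (Real.cos t : ℂ) • 1 + (Complex.I * (Real.sin t : ℂ)) • W
  have hstar : ∀ t, star (r t) = (Real.cos t : ℂ) • 1 - (Complex.I * (Real.sin t : ℂ)) • W := by
    intro t
    have hWs : star W = W := hw1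
    have e : star (Complex.I * (Real.sin t : ℂ)) = -(Complex.I * (Real.sin t : ℂ)) := by
      simp [Complex.conj_ofReal, -Complex.ofReal_sin]
    have e' : star (Real.cos t : ℂ) = Real.cos t := Complex.conj_ofReal _
    simp only [r, star_add, star_smul, star_one, hWs, e, e', sub_eq_add_neg, neg_smul]
  have hcs : ∀ t : ℝ, (Real.cos t : ℂ) * Real.cos t
      - (Complex.I * (Real.sin t : ℂ)) * (Complex.I * (Real.sin t : ℂ)) = 1 := by
    intro t
    have : (Real.sin t : ℂ) ^ 2 + (Real.cos t : ℂ) ^ 2 = 1 := by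
      exact_mod_cast Real.sin_sq_add_cos_sq t
    linear_combination this - (Real.sin t : ℂ) ^ 2 * Complex.I_sq
  have mulaux : ∀ c s : ℂ, ((c • 1 + s • W) * (c • 1 - s • W) = (c * c - s * s) • 1) ∧
      ((c • 1 - s • W) * (c • 1 + s • W) = (c * c - s * s) • 1) := by
    intro c s
    have hW : W * W = 1 := hw2
    constructor
    · simp only [add_mul, mul_sub, smul_add, smul_mul_assoc, mul_smul_comm, one_mul, mul_one, hW, smul_smul,
        sub_smul]
      rw [mul_comm s c]
      abel
    · simp only [sub_mul, mul_add, smul_sub, smul_mul_assoc, mul_smul_comm, one_mul, mul_one, hW, smul_smul,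
        sub_smul]
      rw [mul_comm s c]
      abel
  have hr : ∀ t, r t ∈ unitary (CStarMatrix (Fin n) (Fin n) A) := by
    intro t
    rw [Unitary.mem_iff, hstar]
    exact ⟨by rw [(mulaux _ _).2, hcs, one_smul], by rw [(mulaux _ _).1, hcs, one_smul]⟩
  have hrc : Continuous r := by
    have h1 : Continuous fun t : ℝ => (Real.cos t : ℂ) := by fun_prop
    have h2 : Continuous fun t : ℝ => Complex.I * (Real.sin t : ℂ) := by fun_prop
    exact continuous_pi fun a => continuous_pi fun b =>
      (h1.smul continuous_const).add (h2.smul continuous_const)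
  let R : ℝ → U n A := fun t => ⟨r t, hr t⟩
  have hRc : Continuous R := hrc.subtype_mk _
  have hF : Continuous fun t : ℝ => R t * q * star (R t) :=
    (hRc.mul continuous_const).mul hRc.star
  have hj : Joined (R 0 * q * star (R 0)) (R (Real.pi / 2) * q * star (R (Real.pi / 2))) :=
    (PathConnectedSpace.joined (0 : ℝ) (Real.pi / 2)).map hF
  have h0 : R 0 * q * star (R 0) = q := by
    have : R 0 = 1 := Subtype.ext (by simp [R, r])
    simp [this]
  have h1 : R (Real.pi / 2) * q * star (R (Real.pi / 2)) = w * q * star w := by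
    apply Subtype.ext
    change r (Real.pi / 2) * q.1 * star (r (Real.pi / 2)) = W * q.1 * star W
    rw [hstar]
    have hWs : star W = W := hw1
    simp only [r, hWs, Real.cos_pi_div_two, Real.sin_pi_div_two, Complex.ofReal_zero, zero_smul,
      zero_add, zero_sub, Complex.ofReal_one, mul_one, smul_mul_assoc, mul_neg, mul_smul_comm,
      smul_smul, Complex.I_mul_I, neg_smul, one_smul, neg_neg]
  rwa [h0, h1] at hj

/-- `(u ⊕ 1) (v ⊕ 1)` and `(v ⊕ 1) (u ⊕ 1)` lie in the same path component of `U_{n + n}(A)`. -/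
theorem joined_mul_comm {n : ℕ} (u v : U n A) :
    Joined (padU (Nat.le_add_right n n) (u * v)) (padU (Nat.le_add_right n n) (v * u)) := by
  let e := finSumFinEquiv (m := n) (n := n)
  let W₀ : Matrix (Fin (n + n)) (Fin (n + n)) A :=
    Matrix.reindex e e (Matrix.fromBlocks 0 1 1 0)
  have hW₀s : star W₀ = W₀ := by
    simp [W₀, Matrix.star_eq_conjTranspose, Matrix.conjTranspose_submatrix,
      Matrix.fromBlocks_conjTranspose]
  have hW₀m : W₀ * W₀ = 1 := by
    simp [W₀, Matrix.submatrix_mul_equiv, Matrix.fromBlocks_multiply, Matrix.fromBlocks_one]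
  let W : U (n + n) A := ⟨CStarMatrix.ofMatrix W₀, by
    have h1 : star W₀ * W₀ = 1 := by rw [hW₀s, hW₀m]
    have h2 : W₀ * star W₀ = 1 := by rw [hW₀s, hW₀m]
    exact Unitary.mem_iff.2 ⟨h1, h2⟩⟩
  have hWs : star W = W := Subtype.ext hW₀s
  set P := padU (A := A) (Nat.le_add_right n n)
  have hcomm : P u * (W * P v * star W) = (W * P v * star W) * P u := by
    apply Subtype.ext
    rw [hWs]
    have key : ∀ x y : Matrix (Fin n) (Fin n) A,
        Matrix.reindex e e (Matrix.fromBlocks x 0 0 1) *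
          (W₀ * Matrix.reindex e e (Matrix.fromBlocks y 0 0 1) * W₀) =
        (W₀ * Matrix.reindex e e (Matrix.fromBlocks y 0 0 1) * W₀) *
          Matrix.reindex e e (Matrix.fromBlocks x 0 0 1) := by
      intro x y
      simp [W₀, Matrix.submatrix_mul_equiv, Matrix.fromBlocks_multiply]
    have := key u.1 v.1
    change pad (n + n) u.1 * (W.1 * pad (n + n) v.1 * W.1) =
      (W.1 * pad (n + n) v.1 * W.1) * pad (n + n) u.1
    rw [pad_add, pad_add]
    exact this
  have hq := joined_conj W (P v) hWs
  have h1 : Joined (P u * P v) (P u * (W * P v * star W)) :=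
    hq.map (continuous_const.mul continuous_id)
  have h2 : Joined (P v * P u) ((W * P v * star W) * P u) :=
    hq.map (continuous_id.mul continuous_const)
  rw [map_mul, map_mul]
  rw [hcomm] at h1
  exact h1.trans h2.symm

end

end CStarK1

/-- `K₁(A) = U_∞(A) / ∼₁` for a unital C⋆-algebra `A`. -/
def CStarK1 (A : Type*) [CStarAlgebra A] : Type _ := Quotient (CStarK1.relSetoid A)

namespace CStarK1

variable {A : Type*} [CStarAlgebra A]

/-- The class `[u]₁` of a unitary `u ∈ U_n(A)`. -/
def mk {n : ℕ} (u : U n A) : CStarK1 A := Quotient.mk (relSetoid A) ⟨n, u⟩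

theorem mk_padU {n k : ℕ} (h : n ≤ k) (u : U n A) : mk (padU h u) = mk u :=
  (Quotient.sound (s := relSetoid A) (Rel.mk_pad h u)).symm

theorem mk_eq_of_joined {n : ℕ} {u v : U n A} (h : Joined u v) : mk u = mk v :=
  Quotient.sound (s := relSetoid A) ⟨n, le_rfl, le_rfl, joined_padU le_rfl h⟩

/-- The group operation of `K₁(A)`: `[u] + [v] = [u v]` after enlarging `u`, `v` to matrices of
the same size (this is also the class of `u ⊕ v`). -/
instance instAdd : Add (CStarK1 A) where
  add := Quotient.map₂ (sa := relSetoid A) (sb := relSetoid A) (sc := relSetoid A)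
    (fun u v => ⟨max u.1 v.1, padU (le_max_left u.1 v.1) u.2 * padU (le_max_right u.1 v.1) v.2⟩) <| by
      rintro ⟨m, u⟩ ⟨m', u'⟩ ⟨k, hm, hm', h⟩ ⟨n, v⟩ ⟨n', v'⟩ ⟨l, hn, hn', h'⟩
      dsimp only at *
      have kl := le_max_left k l
      have lk := le_max_right k l
      refine ⟨max k l, max_le (hm.trans kl) (hn.trans lk),
        max_le (hm'.trans kl) (hn'.trans lk), ?_⟩
      have e := joined_padU kl h
      have e' := joined_padU lk h'
      simp only [padU_padU, map_mul] at e e' ⊢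
      obtain ⟨γ⟩ := e
      obtain ⟨γ'⟩ := e'
      exact ⟨γ.mul γ'⟩

theorem mk_add_mk {n : ℕ} (u v : U n A) : mk u + mk v = mk (u * v) := by
  have : mk u + mk v = mk (padU (le_max_left n n) u * padU (le_max_right n n) v) := rfl
  rw [this, ← map_mul, mk_padU]

instance instZero : Zero (CStarK1 A) where
  zero := mk (1 : U 0 A)

theorem mk_one (n : ℕ) : mk (1 : U n A) = 0 := by
  rw [← map_one (padU (A := A) (Nat.zero_le n)), mk_padU]
  rfl

instance instNeg : Neg (CStarK1 A) where
  neg := Quotient.map (sa := relSetoid A) (sb := relSetoid A) (fun u => ⟨u.1, star u.2⟩) <| by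
    rintro ⟨m, u⟩ ⟨n, v⟩ ⟨k, hm, hn, h⟩
    refine ⟨k, hm, hn, ?_⟩
    have e : Joined (star (padU hm u)) (star (padU hn v)) := h.map continuous_star
    simpa only [Unitary.star_eq_inv, map_inv] using e

theorem neg_mk {n : ℕ} (u : U n A) : -mk u = mk (star u) := rfl

theorem ind₃ {P : CStarK1 A → CStarK1 A → CStarK1 A → Prop}
    (h : ∀ (n : ℕ) (u v w : U n A), P (mk u) (mk v) (mk w)) (x y z : CStarK1 A) : P x y z := by
  obtain ⟨⟨l, u⟩, rfl⟩ := Quotient.exists_rep x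
  obtain ⟨⟨m, v⟩, rfl⟩ := Quotient.exists_rep y
  obtain ⟨⟨n, w⟩, rfl⟩ := Quotient.exists_rep z
  have := h (l + m + n) (padU (by omega) u) (padU (by omega) v) (padU (by omega) w)
  rwa [mk_padU, mk_padU, mk_padU] at this

noncomputable instance instAddCommGroup : AddCommGroup (CStarK1 A) where
  add_assoc := ind₃ fun n u v w => by simp only [mk_add_mk, mul_assoc]
  zero_add x := ind₃ (P := fun x _ _ => 0 + x = x)
    (fun n u _ _ => by rw [← mk_one n, mk_add_mk, one_mul]) x x x
  add_zero x := ind₃ (P := fun x _ _ => x + 0 = x)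
    (fun n u _ _ => by rw [← mk_one n, mk_add_mk, mul_one]) x x x
  neg_add_cancel x := ind₃ (P := fun x _ _ => -x + x = 0)
    (fun n u _ _ => by rw [neg_mk, mk_add_mk, Unitary.star_mul_self, mk_one]) x x x
  add_comm x y := ind₃ (P := fun x y _ => x + y = y + x)
    (fun n u v _ => by
      rw [mk_add_mk, mk_add_mk, ← mk_padU (Nat.le_add_right n n),
        mk_eq_of_joined (joined_mul_comm u v), mk_padU]) x y x
  nsmul := nsmulRec
  zsmul := zsmulRec

end CStarK1

/-! The algebra `A` embeds by some `π` into an algebra `B` in which `π(A)` commutes with two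
isometries `s 0`, `s 1` whose ranges are complementary: take the sum of all GNS representations,
repeat it countably often, and let the isometries split the copies into even and odd ones
(`CStarAlgebra.exists_embedding_commute_isometries`). A unitary `v` with entries in `π(A)` is then
the product of its two corner copies `s v s⋆ + (1 - s s⋆)`. Each corner copy has the same class as
`v`, since a unitary dilation of `s` conjugates one to the other after padding. Hence `[v] = [v] +
[v]`, and `[v] = 0` in `K₁(B)` (`CStarK1.mk_eq_zero_of_commute`).

So after padding, the image of a given unitary of `A` is joined to `1`, which means that it is a
finite product of exponentials `exp (i h)`. Once `exp` is replaced by a Taylor polynomial, being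
close to such a product is expressed by a quantifier-free formula with the `h` as variables. The
embedding is existential, so the unitary is also close to a product of exponentials over `A`.
Unitaries at distance less than `2` are joined, so its class over `A` is zero
(`CStarK1.joined_one_of_isExistentialEmbedding`). -/

open scoped ComplexOrder ComplexStarModule

/-! ### A faithful representation with two complementary isometries in its commutant. -/

/-- Positive linear functionals separate the nonzero positive elements of a C⋆-algebra from `0`. -/
theorem PositiveLinearMap.exists_apply_ne_zero {A : Type*} [CStarAlgebra A] [PartialOrder A]
    [StarOrderedRing A] {b : A} (hb : 0 ≤ b) (hb0 : b ≠ 0) : ∃ f : A →ₚ[ℂ] ℂ, f b ≠ 0 := by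
  -- The positive cone is closed and convex and misses `-b`, so Hahn–Banach separates the two.
  let C : ProperCone ℝ A :=
    { carrier := {x | 0 ≤ x}
      add_mem' := fun hx hy => add_nonneg hx hy
      zero_mem' := le_rfl
      smul_mem' := fun c x hx => smul_nonneg c.2 hx
      isClosed' := isClosed_Ici }
  have hbC : -b ∉ C := fun h => hb0 (le_antisymm (neg_nonneg.1 h) hb)
  obtain ⟨g, hg, hgb⟩ := C.hyperplane_separation_point hbC
  -- The real functional `g` may be nonzero on skew-adjoint elements. Precomposing with the real
  -- part removes this, so the complex extension still agrees with `g` on self-adjoint elements.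
  let g' : Module.Dual ℝ A := g.toLinearMap ∘ₗ (selfAdjoint.submodule ℝ A).subtype ∘ₗ realPart
  let f : Module.Dual ℂ A := g'.extendRCLike
  have hf : ∀ x : A, IsSelfAdjoint x → f x = g x := by
    intro x hx
    have h1 : g' x = g x := by
      change g (ℜ x : A) = g x
      rw [hx.coe_realPart]
    have h2 : g' (Complex.I • x) = 0 := by
      change g (ℜ (Complex.I • x) : A) = 0
      rw [realPart_I_smul, hx.imaginaryPart]
      simp
    simp [f, Module.Dual.extendRCLike_apply, h1, h2]
  have hfmono : ∀ x : A, 0 ≤ x → 0 ≤ f x := by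
    intro x hx
    rw [hf x (.of_nonneg hx)]
    exact_mod_cast hg x hx
  refine ⟨PositiveLinearMap.mk₀ f hfmono, ?_⟩
  change f b ≠ 0
  rw [hf b (.of_nonneg hb)]
  have : g b > 0 := by simpa using hgb
  exact_mod_cast this.ne'

namespace lp

/-- The diagonal operator on a Hilbert sum given by a bounded family of operators. -/
noncomputable def diagonal {ι : Type*} {G : ι → Type*} [∀ i, NormedAddCommGroup (G i)]
    [∀ i, InnerProductSpace ℂ (G i)] (T : ∀ i, G i →L[ℂ] G i) (C : ℝ) (hC : ∀ i, ‖T i‖ ≤ C) :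
    lp G 2 →L[ℂ] lp G 2 :=
  -- Coordinatewise domination by the vector `C • x` yields both square-summability and the norm
  -- bound.
  have hle (x : lp G 2) (i : ι) : ‖T i (x i)‖ ≤ ‖(((C : ℂ) • x : lp G 2) : ∀ i, G i) i‖ := by
    have h0 : 0 ≤ C := (norm_nonneg _).trans (hC i)
    rw [lp.coeFn_smul, Pi.smul_apply, norm_smul, Complex.norm_real, Real.norm_of_nonneg h0]
    exact (T i).le_of_opNorm_le (hC i) _
  LinearMap.mkContinuous
    { toFun x := ⟨fun i => T i (x i), ((lp.memℓp ((C : ℂ) • x)).norm).mono (hle x)⟩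
      map_add' x y := by ext i; simp; rfl
      map_smul' c x := by ext i; simp }
    -- For empty `ι` nothing forces `0 ≤ C`, hence the absolute value.
    |C| fun x => by
      refine (lp.norm_mono two_ne_zero (hle x)).trans (norm_smul_le _ _) |>.trans_eq ?_
      simp

theorem diagonal_apply {ι : Type*} {G : ι → Type*} [∀ i, NormedAddCommGroup (G i)]
    [∀ i, InnerProductSpace ℂ (G i)] (T : ∀ i, G i →L[ℂ] G i) (C : ℝ) (hC : ∀ i, ‖T i‖ ≤ C)
    (x : lp G 2) (i : ι) : diagonal T C hC x i = T i (x i) := rfl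

/-- The direct sum of a family of representations on Hilbert spaces. -/
noncomputable def sumRep {A : Type*} [CStarAlgebra A] {ι : Type*} {G : ι → Type*}
    [∀ i, NormedAddCommGroup (G i)] [∀ i, InnerProductSpace ℂ (G i)] [∀ i, CompleteSpace (G i)]
    (ρ : ∀ i, A →⋆ₐ[ℂ] (G i →L[ℂ] G i)) : A →⋆ₐ[ℂ] (lp G 2 →L[ℂ] lp G 2) where
  toFun a := diagonal (fun i => ρ i a) ‖a‖ fun i => NonUnitalStarAlgHom.norm_apply_le (ρ i) a
  map_one' := by ext x i; simp [diagonal_apply]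
  map_mul' a b := by ext x i; simp [diagonal_apply]
  map_zero' := by ext x i; simp [diagonal_apply]
  map_add' a b := by ext x i; simp [diagonal_apply]
  commutes' r := by
    ext x i
    simp [diagonal_apply, Algebra.algebraMap_eq_smul_one]
  map_star' a := by
    refine (ContinuousLinearMap.eq_adjoint_iff _ _).2 fun x y => ?_
    rw [lp.inner_eq_tsum, lp.inner_eq_tsum]
    refine tsum_congr fun i => ?_
    rw [diagonal_apply, diagonal_apply, map_star, ContinuousLinearMap.star_eq_adjoint,
      ContinuousLinearMap.adjoint_inner_left]

theorem sumRep_apply {A : Type*} [CStarAlgebra A] {ι : Type*} {G : ι → Type*}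
    [∀ i, NormedAddCommGroup (G i)] [∀ i, InnerProductSpace ℂ (G i)] [∀ i, CompleteSpace (G i)]
    (ρ : ∀ i, A →⋆ₐ[ℂ] (G i →L[ℂ] G i)) (a : A) (x : lp G 2) (i : ι) :
    sumRep ρ a x i = ρ i a (x i) := rfl

section Cuntz

variable {S : Type*} {H : S → Type*} [∀ i, NormedAddCommGroup (H i)]
  [∀ i, InnerProductSpace ℂ (H i)]

/-- The operator on `⨁_{s, m} H s` that restricts a vector to the summands `(s, 2 m + j)`. -/
noncomputable def thin (H : S → Type*) [∀ i, NormedAddCommGroup (H i)]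
    [∀ i, InnerProductSpace ℂ (H i)] (j : Fin 2) :
    lp (fun p : S × ℕ => H p.1) 2 →L[ℂ] lp (fun p : S × ℕ => H p.1) 2 :=
  have hinj : Function.Injective fun p : S × ℕ => (p.1, 2 * p.2 + (j : ℕ)) := by
    rintro ⟨a, m⟩ ⟨b, n⟩ h
    simp only [Prod.mk.injEq] at h ⊢
    exact ⟨h.1, by omega⟩
  have h2 : 0 < (2 : ENNReal).toReal := by norm_num
  have hs (x : lp (fun p : S × ℕ => H p.1) 2) :=
    ((lp.memℓp x).summable h2)
  LinearMap.mkContinuous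
    { toFun x := ⟨fun p => x (p.1, 2 * p.2 + j), memℓp_gen ((hs x).comp_injective hinj)⟩
      map_add' x y := by ext i; simp; rfl
      map_smul' c x := by ext i; simp }
    1 fun x => by
      rw [one_mul]
      refine lp.norm_le_of_tsum_le h2 (norm_nonneg _) ?_
      rw [lp.norm_rpow_eq_tsum h2]
      exact tsum_comp_le_tsum_of_inj (hs x) (fun _ => by positivity) hinj

theorem thin_apply (j : Fin 2) (x : lp (fun p : S × ℕ => H p.1) 2) (p : S × ℕ) :
    thin H j x p = x (p.1, 2 * p.2 + j) := rfl

variable [∀ i, CompleteSpace (H i)]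

/-- The adjoint of restriction to the positions `2 m + i` spreads a vector over these positions and
vanishes on those of the other parity. Pairing with vectors supported in one summand detects this.
-/
theorem adjoint_thin_apply (i j : Fin 2) (x : lp (fun p : S × ℕ => H p.1) 2) (s : S) (m : ℕ) :
    ContinuousLinearMap.adjoint (thin H i) x (s, 2 * m + j) = if i = j then x (s, m) else 0 := by
  classical
  refine ext_inner_left ℂ fun v => ?_
  rw [← lp.inner_single_left (G := fun p : S × ℕ => H p.1) (s, 2 * m + (j : ℕ)) v,
    ContinuousLinearMap.adjoint_inner_right]
  have : thin H i (lp.single 2 ((s, 2 * m + (j : ℕ)) : S × ℕ) v) =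
      if i = j then lp.single (E := fun p : S × ℕ => H p.1) 2 ((s, m) : S × ℕ) v else 0 := by
    ext ⟨r, n⟩
    rw [thin_apply]
    by_cases h : i = j ∧ r = s ∧ n = m
    · obtain ⟨rfl, rfl, rfl⟩ := h
      simp
    · have hne : ((r, 2 * n + (i : ℕ)) : S × ℕ) ≠ (s, 2 * m + (j : ℕ)) := by
        simp only [ne_eq, Prod.mk.injEq]
        rintro ⟨rfl, h'⟩
        exact h ⟨Fin.ext (by omega), rfl, by omega⟩
      rw [lp.single_apply_ne _ _ _ hne]
      split_ifs with hij
      · rw [lp.single_apply_ne]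
        simp only [ne_eq, Prod.mk.injEq]
        exact fun h' => h ⟨hij, h'⟩
      · rfl
  rw [this]
  split_ifs
  · rw [lp.inner_single_left]
  · simp

theorem thin_mul_adjoint_thin (i j : Fin 2) :
    thin H i * star (thin H j) = if i = j then 1 else 0 := by
  ext x ⟨s, m⟩
  rw [mul_apply_eq_comp, thin_apply, ContinuousLinearMap.star_eq_adjoint,
    adjoint_thin_apply]
  by_cases h : i = j
  · simp [h]
  · simp [h, Ne.symm h]

theorem adjoint_thin_mul_thin_add :
    star (thin H 0) * thin H 0 + star (thin H 1) * thin H 1 = 1 := by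
  ext x ⟨s, m⟩
  obtain ⟨j, k, rfl⟩ : ∃ (j : Fin 2) (k : ℕ), m = 2 * k + j :=
    ⟨⟨m % 2, by omega⟩, m / 2, (Nat.div_add_mod m 2).symm⟩
  simp only [add_apply, mul_apply_eq_comp, lp.coeFn_add,
    Pi.add_apply, ContinuousLinearMap.star_eq_adjoint, adjoint_thin_apply, thin_apply]
  fin_cases j <;> simp

/-- The isometries are the adjoints of the two `thin` operators. They only move the copies of each
`H s`, and the representation acts identically on all copies. -/
theorem exists_isometries_commute_sumRep {A : Type*} [CStarAlgebra A]
    (ρ : ∀ s, A →⋆ₐ[ℂ] (H s →L[ℂ] H s)) :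
    ∃ s : Fin 2 → (lp (fun p : S × ℕ => H p.1) 2 →L[ℂ] lp (fun p : S × ℕ => H p.1) 2),
      (∀ i j, star (s i) * s j = if i = j then 1 else 0) ∧
      s 0 * star (s 0) + s 1 * star (s 1) = 1 ∧
      ∀ a j, Commute (sumRep (G := fun p : S × ℕ => H p.1) (fun p => ρ p.1) a) (s j) := by
  have hcomm (a : A) (j : Fin 2) :
      Commute (sumRep (G := fun p : S × ℕ => H p.1) (fun p => ρ p.1) a) (thin H j) := by
    ext x p
    rfl
  refine ⟨fun j => star (thin H j), fun i j => ?_, ?_, fun a j => ?_⟩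
  · simp only [star_star, thin_mul_adjoint_thin]
  · simpa only [star_star] using adjoint_thin_mul_thin_add
  · have := (hcomm (star a) j).star_star
    rwa [← map_star, star_star] at this

end Cuntz
end lp

/-- Every C⋆-algebra embeds into a C⋆-algebra in which the commutant of its image contains two
isometries with complementary ranges. -/
theorem CStarAlgebra.exists_embedding_commute_isometries.{u} (A : Type u) [CStarAlgebra A] :
    ∃ (B : Type u) (_ : CStarAlgebra B) (π : A →⋆ₐ[ℂ] B) (s : Fin 2 → B),
      Function.Injective π ∧ (∀ i j, star (s i) * s j = if i = j then 1 else 0) ∧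
      s 0 * star (s 0) + s 1 * star (s 1) = 1 ∧ ∀ a j, Commute (π a) (s j) := by
  let := CStarAlgebra.spectralOrder A
  let := CStarAlgebra.spectralOrderedRing A
  -- The positive functionals form a type in the universe of `A`, so the operator algebra stays in
  -- the universe where existential closedness applies.
  let H : (A →ₚ[ℂ] ℂ) → Type u := fun f => f.GNS
  let π := lp.sumRep (G := fun p : (A →ₚ[ℂ] ℂ) × ℕ => H p.1) fun p => p.1.gnsStarAlgHom
  obtain ⟨s, hs⟩ := lp.exists_isometries_commute_sumRep fun f : A →ₚ[ℂ] ℂ => f.gnsStarAlgHom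
  refine ⟨_, inferInstance, π, s, ?_, hs⟩
  refine (injective_iff_map_eq_zero π).2 fun a ha => ?_
  by_contra ha0
  obtain ⟨f, hf⟩ := PositiveLinearMap.exists_apply_ne_zero (star_mul_self_nonneg a)
    (by simpa using ha0)
  classical
  -- The cyclic vector of `f` is sent to the class of `a`, whose squared norm is `f (star a * a)`.
  have h1 : π a (lp.single 2 ((f, 0) : (A →ₚ[ℂ] ℂ) × ℕ) ((f.toPreGNS 1 : f.PreGNS) : f.GNS))
      (f, 0) = ((f.toPreGNS a : f.PreGNS) : f.GNS) := by
    rw [lp.sumRep_apply, lp.single_apply_self]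
    refine (f.gnsNonUnitalStarAlgHom_apply_coe).trans ?_
    simp
  rw [ha] at h1
  have h2 : ‖f.toPreGNS a‖ = 0 := by
    rw [← UniformSpace.Completion.norm_coe, ← h1]
    simp
  have h3 := f.preGNS_norm_sq (f.toPreGNS a)
  rw [h2] at h3
  exact hf (by simpa using h3.symm)

/-! ### Corner copies of a unitary and their `K₁`-classes. -/

/-- The first summand is a unitary of the corner cut out by `s * star s`, and the second is the unit
of the complementary corner. -/
theorem isometry_conj_mem_unitary {R : Type*} [Ring R] [StarRing R] {s v : R}
    (hs : star s * s = 1) (hv : v ∈ unitary R) :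
    s * v * star s + (1 - s * star s) ∈ unitary R := by
  have hs' (x : R) : star s * (s * x) = x := by rw [← mul_assoc, hs, one_mul]
  have h1 (x : R) : star v * (v * x) = x := by
    rw [← mul_assoc, Unitary.star_mul_self_of_mem hv, one_mul]
  have h2 (x : R) : v * (star v * x) = x := by
    rw [← mul_assoc, Unitary.mul_star_self_of_mem hv, one_mul]
  rw [Unitary.mem_iff]
  simp [add_mul, mul_add, mul_sub, sub_mul, mul_assoc, hs', h1, h2]

theorem isometry_conj_mul {R : Type*} [Ring R] [StarRing R] {s t v : R}
    (hs : star s * s = 1) (ht : star t * t = 1) (hst : star s * t = 0)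
    (hadd : s * star s + t * star t = 1) (hvs : Commute v s) (hvt : Commute v t) :
    (s * v * star s + (1 - s * star s)) * (t * v * star t + (1 - t * star t)) = v := by
  have hs' (x : R) : star s * (s * x) = x := by rw [← mul_assoc, hs, one_mul]
  have ht' (x : R) : star t * (t * x) = x := by rw [← mul_assoc, ht, one_mul]
  have hst' (x : R) : star s * (t * x) = 0 := by rw [← mul_assoc, hst, zero_mul]
  have hts : star t * s = 0 := by simpa using congrArg star hst
  have hts' (x : R) : star t * (s * x) = 0 := by rw [← mul_assoc, hts, zero_mul]
  -- Each complement is the range projection of the other isometry. Multiplying out leaves `s v s⋆ +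
  -- t v t⋆ = v (s s⋆ + t t⋆)`.
  rw [sub_eq_of_eq_add' hadd.symm, sub_eq_of_eq_add hadd.symm]
  simp only [add_mul, mul_add, mul_assoc, hs', ht', hst', hts', mul_zero, zero_add, add_zero]
  rw [← mul_assoc, ← mul_assoc, ← hvs.eq, ← hvt.eq, mul_assoc, mul_assoc, ← mul_add, add_comm,
    hadd, mul_one]

namespace CStarK1

variable {A : Type*} [CStarAlgebra A]

/-- The block matrix `[[a, b], [c, d]]` as an element of `M_{n + n}(A)`. -/
def block {n : ℕ} (a b c d : CStarMatrix (Fin n) (Fin n) A) :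
    CStarMatrix (Fin (n + n)) (Fin (n + n)) A :=
  CStarMatrix.ofMatrix (Matrix.reindex finSumFinEquiv finSumFinEquiv
    (Matrix.fromBlocks (CStarMatrix.ofMatrix.symm a) (CStarMatrix.ofMatrix.symm b)
      (CStarMatrix.ofMatrix.symm c) (CStarMatrix.ofMatrix.symm d)))

theorem pad_eq_block {n : ℕ} (a : CStarMatrix (Fin n) (Fin n) A) :
    pad (n + n) a = block a 0 0 1 := pad_add n a

theorem block_one {n : ℕ} : block (1 : CStarMatrix (Fin n) (Fin n) A) 0 0 1 = 1 := by
  rw [← pad_eq_block, pad_one]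

theorem block_mul {n : ℕ} (a b c d a' b' c' d' : CStarMatrix (Fin n) (Fin n) A) :
    block a b c d * block a' b' c' d' =
      block (a * a' + b * c') (a * b' + b * d') (c * a' + d * c') (c * b' + d * d') := by
  have key : ∀ a b c d a' b' c' d' : Matrix (Fin n) (Fin n) A,
      Matrix.reindex finSumFinEquiv finSumFinEquiv (Matrix.fromBlocks a b c d) *
        Matrix.reindex finSumFinEquiv finSumFinEquiv (Matrix.fromBlocks a' b' c' d') =
      Matrix.reindex finSumFinEquiv finSumFinEquiv (Matrix.fromBlocks (a * a' + b * c')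
        (a * b' + b * d') (c * a' + d * c') (c * b' + d * d')) := by
    intros
    simp [Matrix.submatrix_mul_equiv, Matrix.fromBlocks_multiply]
  exact key a b c d a' b' c' d'

theorem star_block {n : ℕ} (a b c d : CStarMatrix (Fin n) (Fin n) A) :
    star (block a b c d) = block (star a) (star c) (star b) (star d) := by
  have key : ∀ a b c d : Matrix (Fin n) (Fin n) A,
      star (Matrix.reindex finSumFinEquiv finSumFinEquiv (Matrix.fromBlocks a b c d)) =
      Matrix.reindex finSumFinEquiv finSumFinEquiv
        (Matrix.fromBlocks (star a) (star c) (star b) (star d)) := by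
    intros
    simp [Matrix.star_eq_conjTranspose, Matrix.conjTranspose_submatrix,
      Matrix.fromBlocks_conjTranspose]
  exact key a b c d

/-- Conjugate unitaries have the same class. -/
theorem mk_conj {n : ℕ} (w v : U n A) : mk (w * v * star w) = mk v := by
  rw [← mk_add_mk, ← mk_add_mk, ← neg_mk]
  abel

/-- If `s` is an isometry, then `v` and `s v s⋆ + (1 - s s⋆)` have the same class. -/
theorem mk_eq_of_isometry {n : ℕ} (s : CStarMatrix (Fin n) (Fin n) A) (hs : star s * s = 1)
    (v v' : U n A) (hv' : (v' : CStarMatrix (Fin n) (Fin n) A) = s * v * star s + (1 - s * star s)) :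
    mk v' = mk v := by
  set p : CStarMatrix (Fin n) (Fin n) A := 1 - s * star s with hp
  have hsp : star s * p = 0 := by
    rw [hp, mul_sub, mul_one, ← mul_assoc, hs, one_mul, sub_self]
  have hps : p * s = 0 := by
    rw [hp, sub_mul, one_mul, mul_assoc, hs, mul_one, sub_self]
  have hpstar : star p = p := by simp [hp]
  have hpp : p * p = p := by
    nth_rw 1 [hp]
    rw [sub_mul, one_mul, mul_assoc, hsp, mul_zero, sub_zero]
  have hadd : s * star s + p = 1 := by simp [hp]
  -- An isometry need not be invertible, but this block matrix is a unitary dilation of it, and it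
  -- conjugates `v ⊕ 1` to `v' ⊕ 1`.
  let W : U (n + n) A := ⟨block s p 0 (star s), by
    rw [Unitary.mem_iff, star_block, block_mul, block_mul]
    simp [hs, hpstar, hpp, hsp, hps, hadd, add_comm p, block_one]⟩
  have h : padU (Nat.le_add_right n n) v' = W * padU (Nat.le_add_right n n) v * star W := by
    apply Subtype.ext
    change pad (n + n) v'.1 = block s p 0 (star s) * pad (n + n) v.1 * star (block s p 0 (star s))
    rw [pad_eq_block, pad_eq_block, star_block, block_mul, block_mul, hv']
    simp [hs, hpstar, hpp, hsp, hps]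
  rw [← mk_padU (Nat.le_add_right n n), h, mk_conj, mk_padU]

/-- The scalar matrix with a given diagonal entry. -/
def scalar (n : ℕ) (a : A) : CStarMatrix (Fin n) (Fin n) A :=
  CStarMatrix.ofMatrix (Matrix.diagonal fun _ => a)

theorem scalar_mul (n : ℕ) (a b : A) : scalar n (a * b) = scalar n a * scalar n b :=
  (Matrix.diagonal_mul_diagonal (n := Fin n) (fun _ => a) (fun _ => b)).symm

theorem scalar_add (n : ℕ) (a b : A) : scalar n (a + b) = scalar n a + scalar n b :=
  (Matrix.diagonal_add (n := Fin n) (fun _ => a) (fun _ => b)).symm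

theorem scalar_star (n : ℕ) (a : A) : scalar n (star a) = star (scalar n a) :=
  (Matrix.diagonal_conjTranspose (n := Fin n) (fun _ => a)).symm

theorem scalar_one (n : ℕ) : scalar n (1 : A) = 1 := Matrix.diagonal_one

theorem scalar_zero (n : ℕ) : scalar n (0 : A) = 0 := Matrix.diagonal_zero

theorem commute_scalar {n : ℕ} (v : CStarMatrix (Fin n) (Fin n) A) (a : A)
    (h : ∀ i j, Commute (v i j) a) : Commute v (scalar n a) := by
  have key : ∀ v : Matrix (Fin n) (Fin n) A, (∀ i j, Commute (v i j) a) →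
      v * Matrix.diagonal (fun _ => a) = Matrix.diagonal (fun _ => a) * v := by
    intro v h
    ext i j
    rw [Matrix.mul_diagonal, Matrix.diagonal_mul]
    exact h i j
  exact key v h

/-- A unitary matrix whose entries commute with two isometries with complementary ranges has
trivial class. -/
theorem mk_eq_zero_of_commute {n : ℕ} (v : U n A) (s : Fin 2 → A)
    (hs : ∀ i j, star (s i) * s j = if i = j then 1 else 0)
    (hadd : s 0 * star (s 0) + s 1 * star (s 1) = 1)
    (hcomm : ∀ i j k, Commute ((v : CStarMatrix (Fin n) (Fin n) A) i j) (s k)) : mk v = 0 := by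
  have hiso (j : Fin 2) : star (scalar n (s j)) * scalar n (s j) = 1 := by
    simp [← scalar_star, ← scalar_mul, hs, scalar_one]
  have hmem (j : Fin 2) := isometry_conj_mem_unitary (hiso j) v.2
  have hprod := isometry_conj_mul (hiso 0) (hiso 1)
    (by simp [← scalar_star, ← scalar_mul, hs, scalar_zero])
    (by rw [← scalar_star, ← scalar_mul, ← scalar_star, ← scalar_mul, ← scalar_add, hadd,
      scalar_one])
    (commute_scalar _ _ fun i j => hcomm i j 0) (commute_scalar _ _ fun i j => hcomm i j 1)
  have e (j : Fin 2) := mk_eq_of_isometry (scalar n (s j)) (hiso j) v ⟨_, hmem j⟩ rfl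
  -- The two corner copies multiply to `v` and each has the class of `v`, so this class equals its
  -- double and vanishes in the group.
  have h : mk v = mk v + mk v := calc
    mk v = mk (⟨_, hmem 0⟩ * ⟨_, hmem 1⟩) := congrArg mk (Subtype.ext hprod.symm)
    _ = mk v + mk v := by rw [← mk_add_mk, e 0, e 1]
  simpa using h

end CStarK1

/-! ### Matrices of terms -/

namespace CStarTerm

variable {ι : Type} {k : ℕ} {A : Type*} [CStarAlgebra A] (x : ι → A)

/-- The value of a matrix of terms. -/
def evalMat (M : Fin k → Fin k → CStarTerm ι) : CStarMatrix (Fin k) (Fin k) A :=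
  CStarMatrix.ofMatrix fun i j => (M i j).eval x

theorem evalMat_apply (M : Fin k → Fin k → CStarTerm ι) (i j : Fin k) :
    evalMat x M i j = (M i j).eval x := rfl

/-- The sum of a list of terms. -/
def sum (l : List (CStarTerm ι)) : CStarTerm ι := l.foldr add zero

theorem eval_sum (l : List (CStarTerm ι)) : (sum l).eval x = (l.map (eval x)).sum := by
  induction l with
  | nil => rfl
  | cons t l ih =>
    rw [List.map_cons, List.sum_cons, ← ih]
    rfl

/-- The product of two matrices of terms. -/
def mulMat (M N : Fin k → Fin k → CStarTerm ι) : Fin k → Fin k → CStarTerm ι :=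
  fun i j => sum ((List.finRange k).map fun l => mul (M i l) (N l j))

theorem evalMat_mulMat (M N : Fin k → Fin k → CStarTerm ι) :
    evalMat x (mulMat M N) = evalMat x M * evalMat x N := by
  ext i j
  rw [evalMat_apply, mulMat, eval_sum, CStarMatrix.mul_apply, List.map_map, Fin.sum_univ_def]
  rfl

/-- The identity matrix of terms. -/
def oneMat (k : ℕ) (ι : Type) : Fin k → Fin k → CStarTerm ι :=
  fun i j => if i = j then one else zero

theorem evalMat_oneMat : evalMat x (oneMat k ι) = 1 := by
  ext i j
  rw [evalMat_apply, oneMat, CStarMatrix.one_apply]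
  split_ifs <;> rfl

/-- The product of a list of matrices of terms. -/
def prodMat (l : List (Fin k → Fin k → CStarTerm ι)) : Fin k → Fin k → CStarTerm ι :=
  l.foldr mulMat (oneMat k ι)

theorem evalMat_prodMat (l : List (Fin k → Fin k → CStarTerm ι)) :
    evalMat x (prodMat l) = (l.map (evalMat x)).prod := by
  induction l with
  | nil => exact evalMat_oneMat x
  | cons M l ih =>
    rw [List.map_cons, List.prod_cons, ← ih, ← evalMat_mulMat]
    rfl

/-- The `N`-th Taylor polynomial of the exponential function at a matrix of terms. -/
noncomputable def expMat (M : Fin k → Fin k → CStarTerm ι) : ℕ → Fin k → Fin k → CStarTerm ι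
  -- Only degrees below `N` occur, as in the partial sums of the exponential series.
  | 0 => fun _ _ => zero
  | N + 1 => fun i j =>
      add (expMat M N i j) (smul (N.factorial : ℂ)⁻¹ (prodMat (List.replicate N M) i j))

theorem evalMat_expMat (M : Fin k → Fin k → CStarTerm ι) (N : ℕ) :
    evalMat x (expMat M N) =
      ∑ r ∈ Finset.range N, (r.factorial : ℂ)⁻¹ • evalMat x M ^ r := by
  induction N with
  | zero => rfl
  | succ N ih =>
    rw [Finset.sum_range_succ, ← ih, ← List.prod_replicate, ← List.map_replicate,
      ← evalMat_prodMat]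
    rfl

/-- The matrix of terms `i (M + M⋆) / 2`. -/
noncomputable def skewMat (M : Fin k → Fin k → CStarTerm ι) : Fin k → Fin k → CStarTerm ι :=
  fun i j => smul (Complex.I / 2) (add (M i j) (star (M j i)))

/-- Variables range over whole balls, so self-adjointness cannot be imposed on them. It is built
into the term by symmetrizing. -/
theorem evalMat_skewMat (M : Fin k → Fin k → CStarTerm ι) :
    evalMat x (skewMat M) =
      Complex.I • (realPart (evalMat x M) : CStarMatrix (Fin k) (Fin k) A) := by
  have h : evalMat x (skewMat M) = (Complex.I / 2) • (evalMat x M + Star.star (evalMat x M)) := rfl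
  rw [h, realPart_apply_coe, div_eq_mul_inv, mul_smul, ← Complex.coe_smul]
  simp

end CStarTerm

/-- The formula expressing the sum of the norms of the entries of `w - ∏ r, exp (i h r)`, where
`exp` is replaced by its `N`-th Taylor polynomial, `w` is the `k × k` matrix of the parameters, and
`h r` for `r < m` are the real parts of the `k × k` matrices of the remaining variables. -/
noncomputable def CStarQFFormula.distProdExp (k m N : ℕ) :
    CStarQFFormula (Fin (k * k) ⊕ Fin (m * (k * k))) :=
  .conn (k := k * k) ⟨fun y => ∑ s, y s, by fun_prop⟩ fun s =>
    .dist (.var (Sum.inl s)) (CStarTerm.prodMat ((List.finRange m).map fun r =>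
      CStarTerm.expMat (CStarTerm.skewMat fun i j =>
        .var (Sum.inr (finProdFinEquiv (r, finProdFinEquiv (i, j))))) N)
      (finProdFinEquiv.symm s).1 (finProdFinEquiv.symm s).2)

/-- Atomic formulas see only norms in `A`, not norms of matrices. The sum of the entry norms serves
instead, being equivalent to the matrix norm for fixed `k`. -/
theorem CStarQFFormula.eval_distProdExp {A : Type*} [CStarAlgebra A] {k m : ℕ} (N : ℕ)
    (w : CStarMatrix (Fin k) (Fin k) A) (b : Fin (m * (k * k)) → A)
    (c : Fin m → CStarMatrix (Fin k) (Fin k) A)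
    (hc : ∀ r i j, c r i j = b (finProdFinEquiv (r, finProdFinEquiv (i, j)))) :
    (distProdExp k m N).eval
        (Sum.elim (fun s => w (finProdFinEquiv.symm s).1 (finProdFinEquiv.symm s).2) b) =
      ∑ i, ∑ j, ‖(w - ((List.finRange m).map fun r => ∑ l ∈ Finset.range N,
        (l.factorial : ℂ)⁻¹ •
          (Complex.I • (realPart (c r) : CStarMatrix (Fin k) (Fin k) A)) ^ l).prod) i j‖ := by
  set x : Fin (k * k) ⊕ Fin (m * (k * k)) → A :=
    Sum.elim (fun s => w (finProdFinEquiv.symm s).1 (finProdFinEquiv.symm s).2) b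
  have hcr (r : Fin m) : c r = CStarTerm.evalMat x fun i j =>
      .var (Sum.inr (finProdFinEquiv (r, finProdFinEquiv (i, j)))) := by
    ext i j
    exact hc r i j
  have hprod : ((List.finRange m).map fun r => ∑ l ∈ Finset.range N,
        (l.factorial : ℂ)⁻¹ •
          (Complex.I • (realPart (c r) : CStarMatrix (Fin k) (Fin k) A)) ^ l).prod =
      CStarTerm.evalMat x (CStarTerm.prodMat ((List.finRange m).map fun r =>
        CStarTerm.expMat (CStarTerm.skewMat fun i j =>
          .var (Sum.inr (finProdFinEquiv (r, finProdFinEquiv (i, j))))) N)) := by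
    rw [CStarTerm.evalMat_prodMat, List.map_map]
    simp only [Function.comp_def, CStarTerm.evalMat_expMat, CStarTerm.evalMat_skewMat, hcr]
  rw [hprod, ← Fintype.sum_prod_type', ← finProdFinEquiv.symm.sum_comp]
  rfl

/-! ### Norm estimates -/

theorem CStarMatrix.norm_le_sum_norm_entry {k : ℕ} {A : Type*} [CStarAlgebra A] [PartialOrder A]
    [StarOrderedRing A] (M : CStarMatrix (Fin k) (Fin k) A) : ‖M‖ ≤ ∑ i, ∑ j, ‖M i j‖ := by
  rw [norm_def, Finset.sum_comm]
  refine (toCLM M).opNorm_le_bound (by positivity) fun v => ?_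
  simp only [toCLM_apply_eq_sum, Finset.sum_mul]
  apply (WithCStarModule.pi_norm_le_sum_norm _).trans
  gcongr with i _
  change ‖∑ l, v l * M l i‖ ≤ _
  refine (norm_sum_le _ _).trans ?_
  gcongr with j _
  refine (norm_mul_le _ _).trans ?_
  rw [mul_comm]
  gcongr
  exact WithCStarModule.norm_apply_le_norm v j

/-- The exponential series has infinite radius of convergence, so it converges uniformly on bounded
sets. Uniformity matters because the matrices over `A` are found only after `N` is fixed. -/
theorem eventually_norm_taylor_sub_exp_lt {A : Type*} [CStarAlgebra A] (R : ℝ) {δ : ℝ}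
    (hδ : 0 < δ) : ∀ᶠ N in Filter.atTop, ∀ x : A, ‖x‖ ≤ R →
      ‖∑ r ∈ Finset.range N, (r.factorial : ℂ)⁻¹ • x ^ r - NormedSpace.exp x‖ < δ := by
  have h := (NormedSpace.exp_hasFPowerSeriesOnBall (𝕂 := ℂ) (𝔸 := A)).tendstoUniformlyOn
    -- Uniform convergence is available on open balls, and radius `R + 1` covers the closed ball of
    -- radius `R`.
    (r' := Real.toNNReal (R + 1)) ENNReal.coe_lt_top
  filter_upwards [Metric.tendstoUniformlyOn_iff.1 h δ hδ] with N hN x hx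
  have h0 : 0 ≤ ‖x‖ := norm_nonneg x
  have := hN x (by
    rw [mem_ball_zero_iff, Real.coe_toNNReal _ (by linarith)]
    linarith)
  rw [dist_comm, dist_eq_norm, zero_add] at this
  simpa only [FormalMultilinearSeries.partialSum, NormedSpace.expSeries_apply_eq] using this

/-- Unitary factors do not change norms, so one more factor turns an error `e` into at most `δ e + e
+ δ`, that is, `(1 + δ) (1 + e) - 1`. -/
theorem norm_prod_sub_prod_unitary_le {ι A : Type*} [CStarAlgebra A] (l : List ι) (a : ι → A)
    (b : ι → unitary A) {δ : ℝ} (h : ∀ i, ‖a i - b i‖ ≤ δ) :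
    ‖(l.map a).prod - ((l.map b).prod : unitary A)‖ ≤ (1 + δ) ^ l.length - 1 := by
  induction l with
  | nil => simp
  | cons i l ih =>
    set P := (l.map a).prod
    set Q := (l.map b).prod
    rw [List.map_cons, List.map_cons, List.prod_cons, List.prod_cons]
    have e : a i * P - ((b i * Q : unitary A) : A) =
        (a i - b i) * (P - Q) + b i * (P - Q) + (a i - b i) * Q := by
      push_cast
      noncomm_ring
    have hδ : 0 ≤ δ := (norm_nonneg _).trans (h i)
    calc ‖a i * P - ((b i * Q : unitary A) : A)‖
      _ ≤ ‖a i - b i‖ * ‖P - Q‖ + ‖P - Q‖ + ‖a i - b i‖ := by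
        rw [e]
        refine (norm_add_le _ _).trans (add_le_add ((norm_add_le _ _).trans
          (add_le_add (norm_mul_le _ _) ?_)) ?_)
        · rw [CStarRing.norm_coe_unitary_mul]
        · rw [CStarRing.norm_mul_coe_unitary]
      _ ≤ δ * ((1 + δ) ^ l.length - 1) + ((1 + δ) ^ l.length - 1) + δ := by
        gcongr <;> exact h i
      _ = (1 + δ) ^ (i :: l).length - 1 := by
        rw [List.length_cons]
        ring

/-- The value of `distProdExp` is nonnegative. -/
theorem CStarQFFormula.eval_distProdExp_nonneg {A : Type*} [CStarAlgebra A] (k m N : ℕ)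
    (x : Fin (k * k) ⊕ Fin (m * (k * k)) → A) : 0 ≤ (distProdExp k m N).eval x := by
  rw [distProdExp, eval, ContinuousMap.coe_mk]
  refine Finset.sum_nonneg fun s _ => ?_
  rw [eval]
  exact norm_nonneg _

/-! ### Descent of null-homotopy along an existential embedding. -/

namespace CStarK1

variable {A B : Type*} [CStarAlgebra A] [CStarAlgebra B]

/-- The homomorphism `U_n(A) → U_n(B)` induced by a unital ⋆-homomorphism `A → B`. -/
def mapU (π : A →⋆ₐ[ℂ] B) {n : ℕ} (u : U n A) : U n B :=
  ⟨u.1.map π, by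
    have hmap (M : CStarMatrix (Fin n) (Fin n) A) :
        M.map π = CStarMatrix.mapₙₐ (π : A →⋆ₙₐ[ℂ] B) M := rfl
    have hone : (1 : CStarMatrix (Fin n) (Fin n) A).map π = 1 := by
      ext i j
      simp [CStarMatrix.one_apply, apply_ite π]
    rw [Unitary.mem_iff, hmap, ← map_star, ← map_mul, ← map_mul,
      Unitary.star_mul_self_of_mem u.2, Unitary.mul_star_self_of_mem u.2, ← hmap, hone]
    exact ⟨rfl, rfl⟩⟩

theorem mapU_apply (π : A →⋆ₐ[ℂ] B) {n : ℕ} (u : U n A) (i j : Fin n) :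
    (mapU π u : CStarMatrix (Fin n) (Fin n) B) i j =
      π ((u : CStarMatrix (Fin n) (Fin n) A) i j) := rfl

theorem padU_mapU (π : A →⋆ₐ[ℂ] B) {n k : ℕ} (h : n ≤ k) (u : U n A) :
    padU h (mapU π u) = mapU π (padU h u) := by
  refine Subtype.ext (CStarMatrix.ext fun i j => ?_)
  rw [mapU_apply]
  change pad k (mapU π u).1 i j = π (pad k u.1 i j)
  rw [pad_apply, pad_apply]
  split_ifs
  · rfl
  · simp
  · simp

/-- If an existential embedding carries a unitary matrix to the path component of `1`, then this
matrix lies in the path component of `1`. -/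
theorem joined_one_of_isExistentialEmbedding {π : A →⋆ₐ[ℂ] B} (hπ : IsExistentialEmbedding π)
    {k : ℕ} (w : U k A) (hw : Joined 1 (mapU π w)) : Joined 1 w := by
  let := CStarAlgebra.spectralOrder A
  have := CStarAlgebra.spectralOrderedRing A
  let := CStarAlgebra.spectralOrder B
  have := CStarAlgebra.spectralOrderedRing B
  -- The path component of `1` consists of the finite products of exponentials of `i` times
  -- self-adjoint elements.
  obtain ⟨L, hL⟩ := Unitary.mem_pathComponentOne_iff.1 (show mapU π w ∈ pathComponent 1 from hw)
  obtain ⟨m, h, hh⟩ : ∃ (m : ℕ) (h : Fin m → selfAdjoint (CStarMatrix (Fin k) (Fin k) B)),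
      ((List.finRange m).map fun r => selfAdjoint.expUnitary (h r)).prod = mapU π w :=
    ⟨L.length, L.get, by
      rw [← hL]
      conv_rhs => rw [← List.map_get_finRange L]
      rw [List.map_map]
      rfl⟩
  obtain ⟨n, hn1, hn⟩ : ∃ n : ℕ, 1 ≤ n ∧ ∀ r, ‖h r‖ ≤ n := by
    obtain ⟨n, hn⟩ := exists_nat_ge (∑ r, ‖h r‖)
    refine ⟨n + 1, by omega, fun r => ?_⟩
    have := Finset.single_le_sum (f := fun r => ‖h r‖) (fun _ _ => norm_nonneg _)
      (Finset.mem_univ r)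
    push_cast
    linarith
  have hsmall (C : ℝ) : ∃ δ : ℝ, 0 < δ ∧ C * ((1 + δ) ^ m - 1) < 1 := by
    have hc : Continuous fun δ : ℝ => C * ((1 + δ) ^ m - 1) := by fun_prop
    have h0 := hc.tendsto 0
    simp only [add_zero, one_pow, sub_self, mul_zero] at h0
    have := (h0.eventually_lt_const one_pos).filter_mono (nhdsWithin_le_nhds (s := Set.Ioi 0))
    obtain ⟨δ, h1, h2⟩ := (this.and self_mem_nhdsWithin).exists
    exact ⟨δ, h2, h1⟩
  obtain ⟨δ, hδ, hδm⟩ := hsmall 1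
  -- Over `B` a bound on the matrix norm must control the sum of `k * k` entry norms, hence the
  -- factor.
  obtain ⟨η, hη, hηm⟩ := hsmall (k * k)
  rw [one_mul] at hδm
  rw [mul_assoc] at hηm
  have hA := eventually_norm_taylor_sub_exp_lt (A := CStarMatrix (Fin k) (Fin k) A)
    -- The formula bounds only the entries of the matrices over `A` by `n`, so their norms are
    -- bounded by `k * k * n`.
    (∑ _i : Fin k, ∑ _j : Fin k, (n : ℝ)) hδ
  have hB := eventually_norm_taylor_sub_exp_lt (A := CStarMatrix (Fin k) (Fin k) B) (n : ℝ) hη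
  -- The same formula is evaluated in both algebras, so one `N` must serve both.
  obtain ⟨N, hNA, hNB⟩ := (hA.and hB).exists
  set φ := CStarQFFormula.distProdExp k m N
  set a : Fin (k * k) → A := fun s => w.1 (finProdFinEquiv.symm s).1 (finProdFinEquiv.symm s).2
  have hinfB : φ.infBall n (fun s => π (a s)) < 1 := by
    let b : Fin (m * (k * k)) → B := fun s =>
      (h (finProdFinEquiv.symm s).1 : CStarMatrix (Fin k) (Fin k) B)
        (finProdFinEquiv.symm (finProdFinEquiv.symm s).2).1
        (finProdFinEquiv.symm (finProdFinEquiv.symm s).2).2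
    have hb : ∀ s, ‖b s‖ ≤ n := fun s => CStarMatrix.norm_entry_le_norm.trans (hn _)
    refine (ciInf_le ⟨0, ?_⟩ (⟨b, hb⟩ : {b : Fin (m * (k * k)) → B // ∀ j, ‖b j‖ ≤ n})).trans_lt ?_
    · rintro _ ⟨c, rfl⟩
      exact CStarQFFormula.eval_distProdExp_nonneg _ _ _ _
    · have := CStarQFFormula.eval_distProdExp N (mapU π w).1 b (fun r => (h r).1)
        (fun r i j => by simp only [b, Equiv.symm_apply_apply])
      refine this.trans_lt ?_
      set P := ((List.finRange m).map fun r => ∑ l ∈ Finset.range N, (l.factorial : ℂ)⁻¹ •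
          (Complex.I • (realPart (h r).1 : CStarMatrix (Fin k) (Fin k) B)) ^ l).prod with hP
      have hclose : ‖(mapU π w).1 - P‖ ≤ (1 + η) ^ m - 1 := by
        rw [norm_sub_rev, ← hh, hP]
        refine (norm_prod_sub_prod_unitary_le (List.finRange m) _
          (fun r => selfAdjoint.expUnitary (h r)) (δ := η) fun r => ?_).trans_eq
          (by rw [List.length_finRange])
        rw [(h r).2.coe_realPart, selfAdjoint.expUnitary_coe]
        refine (hNB _ ?_).le
        rw [norm_smul, Complex.norm_I, one_mul]
        exact hn r
      calc ∑ i, ∑ j, ‖((mapU π w).1 - P) i j‖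
        _ ≤ ∑ _i : Fin k, ∑ _j : Fin k, ((1 + η) ^ m - 1) := by
          gcongr
          exact CStarMatrix.norm_entry_le_norm.trans hclose
        _ < 1 := by
          simpa only [Finset.sum_const, Finset.card_univ, Fintype.card_fin, nsmul_eq_mul] using hηm
  rw [← hπ.2 _ _ φ n hn1 a] at hinfB
  have : Nonempty {b : Fin (m * (k * k)) → A // ∀ j, ‖b j‖ ≤ n} := ⟨⟨0, by simp⟩⟩
  obtain ⟨⟨b, hb⟩, hφ⟩ := exists_lt_of_ciInf_lt hinfB
  let c : Fin m → CStarMatrix (Fin k) (Fin k) A := fun r => CStarMatrix.ofMatrix fun i j =>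
    b (finProdFinEquiv (r, finProdFinEquiv (i, j)))
  have hval := CStarQFFormula.eval_distProdExp N w.1 b c fun _ _ _ => rfl
  have h1 := (CStarMatrix.norm_le_sum_norm_entry _).trans_lt (hval.symm.trans_lt hφ)
  have hc (r : Fin m) : ‖(realPart (c r) : CStarMatrix (Fin k) (Fin k) A)‖ ≤
      ∑ _i : Fin k, ∑ _j : Fin k, (n : ℝ) := by
    refine (realPart.norm_le (c r)).trans ((CStarMatrix.norm_le_sum_norm_entry _).trans ?_)
    gcongr
    exact hb _
  have h2 := (norm_prod_sub_prod_unitary_le (List.finRange m)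
    (fun r => ∑ l ∈ Finset.range N, (l.factorial : ℂ)⁻¹ •
      (Complex.I • (realPart (c r) : CStarMatrix (Fin k) (Fin k) A)) ^ l)
    (fun r => selfAdjoint.expUnitary (realPart (c r))) (δ := δ) fun r => by
      rw [selfAdjoint.expUnitary_coe]
      refine (hNA _ ?_).le
      rw [norm_smul, Complex.norm_I, one_mul]
      exact hc r).trans_lt (by rwa [List.length_finRange])
  have hE : Joined 1 ((List.finRange m).map
      fun r => selfAdjoint.expUnitary (realPart (c r))).prod :=
    Unitary.mem_pathComponentOne_iff.2
      ⟨(List.finRange m).map fun r => realPart (c r), by rw [List.map_map]; rfl⟩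
  -- The formula and the Taylor error each contribute less than `1`, and unitaries at distance less
  -- than `2` are joined.
  refine hE.trans (Unitary.joined _ _ ?_)
  refine (norm_sub_le_norm_sub_add_norm_sub _ _ _).trans_lt ((add_lt_add h1 h2).trans_eq ?_)
  norm_num

end CStarK1

theorem mainTheorem7 (A : Type*) [CStarAlgebra A] (hA : IsExistentiallyClosedCStar A) :
    ∀ x : CStarK1 A, x = 0 := by
  intro x
  obtain ⟨⟨n, u⟩, rfl⟩ := Quotient.exists_rep x
  obtain ⟨B, _, π, s, hπ, hs, hadd, hcomm⟩ := CStarAlgebra.exists_embedding_commute_isometries A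
  have h0 : CStarK1.mk (CStarK1.mapU π u) = 0 :=
    CStarK1.mk_eq_zero_of_commute _ s hs hadd fun i j k => hcomm _ k
  -- Zero is the class of the `0 × 0` unitary, so this gives a size at which the padded image of `u`
  -- is joined to `1`. Padding commutes with `π`, so that matrix comes from `A`.
  obtain ⟨k, hk, hk', hj⟩ := Quotient.exact (s := CStarK1.relSetoid B) h0
  have hj' : Joined 1 (CStarK1.mapU π (CStarK1.padU hk u)) := by
    rw [← CStarK1.padU_mapU]
    simpa using hj.symm
  have := CStarK1.mk_eq_of_joined (CStarK1.joined_one_of_isExistentialEmbedding (hA B π hπ) _ hj')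
  rw [CStarK1.mk_one, CStarK1.mk_padU] at this
  exact this.symm
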